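/- Conventions. Initial and terminal objects are denoted by $0$ and $1$. A category is *Barr exact* if it has finite limits, every kernel pair in it has a coequalizer, regular epimorphisms are stable under pullback, and every internal equivalence relation is effective (the kernel pair of its coequalizer). For an object $B$ of a category with pullbacks, $\mathrm{Pt}(B)$ denotes the category of points over $B$: its objects are triples $(X,\,p:X\to B,\,s:B\to X)$ with $ps=1_B$, and its morphisms are the morphisms between the objects $X$ that commute with both the $p$'s and the $s$'s. A category with pullbacks is *Bourn protomodular* if, for every morphism $b:E\to B$, the pullback functor $b^*:\mathrm{Pt}(B)\to\mathrm{Pt}(E)$ reflects isomorphisms. A category is *semi-abelian* if it is pointed (has a zero object), Barr exact, Bourn protomodular, and has finite coproducts. A functor $U:\mathcal A\to\mathcal X$ is *monadic* if it has a left adjoint $F$ and the comparison functor from $\mathcal A$ to the category of Eilenberg–Moore algebras of the monad on $\mathcal X$ determined by the adjunction $F\dashv U$ is an equivalence; the underlying functor of this monad is $UF:\mathcal X\to\mathcal X$. Theorem. The following conditions on a category $\mathcal A$ are equivalent: (a) $\mathcal A$ is Barr exact and Bourn protomodular, $\mathcal A$ has finite coproducts, and the unique morphism $0\to 1$ in $\mathcal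 A$ is a regular epimorphism; (b) $\mathcal A$ is Barr exact and has finite coproducts, and there exists a monadic functor $\mathcal A\to\mathcal X$ with $\mathcal X$ semi-abelian; (c) there exists a monadic functor $\mathcal A\to\mathcal X$ with $\mathcal X$ semi-abelian such that the underlying functor of the corresponding monad on $\mathcal X$ preserves regular epimorphisms and kernel pairs (that is, it sends every regular epimorphism to a regular epimorphism, and every kernel pair of a morphism $f$ to a kernel pair of the image of $f$). A category satisfying these equivalent conditions is called *ideally exact*. -/

import Mathlib

open CategoryTheory Limits

universe v u w w'

-- Make `⟶` elaborate to the hom-types of the category structure itself.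
attribute [-instance] catToReflQuiver

namespace IdeallyExact

/-- A category is Barr exact if it is regular (finitely complete, with coequalizers of kernel pairs
and with regular epimorphisms stable under pullback) and every internal equivalence relation in it
is effective, that is, it is the kernel pair of its coequalizer. -/
class BarrExact (C : Type u) [Category.{v} C] : Prop extends Regular C where
  isEffective {R X : C} (p₁ p₂ : R ⟶ X) [IsEquivalenceRelation p₁ p₂] :
    IsEffectiveEquivalenceRelation p₁ p₂

/-- A point over `B`: an object over `B` whose structure morphism `p` is a split epimorphism
with a specified section `s`. -/
structure Point {C : Type u} [Category.{v} C] (B : C) where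
  /-- the underlying object -/
  obj : C
  /-- the split epimorphism -/
  p : obj ⟶ B
  /-- the specified section -/
  s : B ⟶ obj
  s_p : s ≫ p = 𝟙 B

/-- Morphisms of points over `B` commute both with the projections to `B` and with the sections. -/
@[ext]
structure Point.Hom {C : Type u} [Category.{v} C] {B : C} (X Y : Point B) where
  /-- the underlying morphism -/
  hom : X.obj ⟶ Y.obj
  hom_p : hom ≫ Y.p = X.p
  s_hom : X.s ≫ hom = Y.s

attribute [simp] Point.s_p Point.Hom.hom_p Point.Hom.s_hom

/-- The category `Pt(B)` of points over `B`. -/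
instance Point.category {C : Type u} [Category.{v} C] (B : C) : Category.{v} (Point B) where
  Hom X Y := Point.Hom X Y
  id X := { hom := 𝟙 X.obj, hom_p := by simp, s_hom := by simp }
  comp f g :=
    { hom := f.hom ≫ g.hom
      hom_p := by simp
      s_hom := by rw [← Category.assoc, f.s_hom, g.s_hom] }
  id_comp f := Point.Hom.ext (Category.id_comp f.hom)
  comp_id f := Point.Hom.ext (Category.comp_id f.hom)
  assoc f g h := Point.Hom.ext (Category.assoc f.hom g.hom h.hom)

@[ext]
theorem Point.hom_ext {C : Type u} [Category.{v} C] {B : C} {X Y : Point B} {f g : X ⟶ Y}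
    (h : f.hom = g.hom) : f = g :=
  Point.Hom.ext h

@[simp]
theorem Point.id_hom {C : Type u} [Category.{v} C] {B : C} (X : Point B) :
    (𝟙 X : X ⟶ X).hom = 𝟙 X.obj :=
  rfl

@[simp]
theorem Point.comp_hom {C : Type u} [Category.{v} C] {B : C} {X Y Z : Point B} (f : X ⟶ Y)
    (g : Y ⟶ Z) : (f ≫ g).hom = f.hom ≫ g.hom :=
  rfl

/-- The change-of-base functor `b^* : Pt(B) ⥤ Pt(E)` along `b : E ⟶ B`: it sends a point `(p, s)`
to the pullback of `p` along `b`, with the section induced by `s`. -/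
@[simps]
noncomputable def Point.changeOfBase {C : Type u} [Category.{v} C] [HasPullbacks C] {E B : C}
    (b : E ⟶ B) : Point B ⥤ Point E where
  obj X :=
    { obj := pullback X.p b
      p := pullback.snd X.p b
      s := pullback.lift (b ≫ X.s) (𝟙 E) (by simp)
      s_p := pullback.lift_snd _ _ _ }
  map {X Y} f :=
    { hom := pullback.map X.p b Y.p b f.hom (𝟙 E) (𝟙 B) (by simp) (by simp)
      hom_p := by simp [pullback.map, pullback.lift_snd]
      s_hom := by
        ext <;>
          simp [pullback.map, pullback.lift_fst, pullback.lift_snd, pullback.lift_fst_assoc] }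
  map_id X := by
    ext
    all_goals simp [pullback.map]
  map_comp {X Y Z} f g := by
    ext <;>
      simp [pullback.map, pullback.lift_fst, pullback.lift_snd, pullback.lift_fst_assoc]

/-- A category with pullbacks is Bourn protomodular if every change-of-base functor
`b^* : Pt(B) ⥤ Pt(E)` between categories of points reflects isomorphisms. -/
class BournProtomodular (C : Type u) [Category.{v} C] : Prop extends HasPullbacks C where
  reflectsIsomorphisms {E B : C} (b : E ⟶ B) : (Point.changeOfBase b).ReflectsIsomorphisms

/-- A category is semi-abelian if it is pointed, Barr exact, Bourn protomodular, and has finite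
coproducts. -/
class SemiAbelian (C : Type u) [Category.{v} C] : Prop extends
    HasZeroObject C, BarrExact C, BournProtomodular C where
  hasFiniteCoproducts : HasFiniteCoproducts C

attribute [instance] SemiAbelian.hasFiniteCoproducts

/-- A functor preserves regular epimorphisms if it sends regular epimorphisms to regular
epimorphisms. -/
def PreservesRegularEpis {C : Type*} [Category* C] {D : Type*} [Category* D] (F : C ⥤ D) : Prop :=
  ∀ ⦃X Y : C⦄ (f : X ⟶ Y), IsRegularEpi f → IsRegularEpi (F.map f)

/-- A functor preserves kernel pairs if it sends each kernel pair of a morphism `f` to a kernel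
pair of the image of `f`. -/
def PreservesKernelPairs {C : Type*} [Category* C] {D : Type*} [Category* D] (F : C ⥤ D) : Prop :=
  ∀ ⦃R X Y : C⦄ (f : X ⟶ Y) (a b : R ⟶ X),
    IsKernelPair f a b → IsKernelPair (F.map f) (F.map a) (F.map b)

end IdeallyExact

-- (a) ⇒ (c): take for `X` the slice over the initial object `0`. The object `1_0` is both initial
-- and terminal there, and exactness, protomodularity and finite coproducts pass to slices, so the
-- slice is semi-abelian. The functor `0 × -` is right adjoint to the forgetful functor. It is
-- conservative because `0 ⟶ 1` is a regular epimorphism, and it preserves pullbacks and regular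
-- epimorphisms. In an exact protomodular category reflexive relations are equivalence relations, so
-- a reflexive coequalizer is the quotient by an image relation; `0 × -` therefore preserves it, and
-- crude monadicity applies.
--
-- (c) ⇒ (b): the monad preserves quotients of equivalence relations, so `U` creates them and
-- exactness lifts. Protomodularity lifts too, which yields reflexive coequalizers and hence finite
-- coproducts.
--
-- (b) ⇒ (a): `U` is conservative and preserves pullbacks, so protomodularity lifts. As `U 1` is a
-- zero object, `F U 1` is initial, and the counit at `1` is the map `0 ⟶ 1`.

attribute [local simp] pullback.lift_fst pullback.lift_snd pullback.lift_fst_assoc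
  pullback.lift_snd_assoc prod.lift_fst prod.lift_snd prod.lift_fst_assoc prod.lift_snd_assoc

namespace IdeallyExact

/-! ### Protomodularity and its transfer along conservative functors. -/

section Protomodular

variable {C : Type*} [Category* C] {D : Type*} [Category* D]

/-- A morphism of points is invertible as soon as its underlying morphism is. -/
theorem Point.isIso_of_isIso_hom {B : C} {X Y : Point B} (f : X ⟶ Y) [IsIso f.hom] : IsIso f :=
  ⟨{ hom := inv f.hom
     hom_p := by rw [IsIso.inv_comp_eq, f.hom_p]
     s_hom := by rw [IsIso.comp_inv_eq, f.s_hom] },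
    by ext; exact IsIso.hom_inv_id f.hom, by ext; exact IsIso.inv_hom_id f.hom⟩

theorem Point.isIso_hom_of_isIso {B : C} {X Y : Point B} (f : X ⟶ Y) [IsIso f] : IsIso f.hom :=
  ⟨(inv f).hom, congrArg Point.Hom.hom (IsIso.hom_inv_id f),
    congrArg Point.Hom.hom (IsIso.inv_hom_id f)⟩

/-- In a protomodular category, a morphism between split epimorphisms over `B` that is compatible
with sections is invertible if its pullback along some `b : E ⟶ B` is. -/
theorem isIso_of_isPullback_of_section [BournProtomodular C] {E B X Y X' Y' : C} {b : E ⟶ B}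
    {f : X ⟶ Y} {p : Y ⟶ B} {s : B ⟶ X} (hs : s ≫ f ≫ p = 𝟙 B)
    {x : X' ⟶ X} {x' : X' ⟶ E} (hx : IsPullback x x' (f ≫ p) b)
    {y : Y' ⟶ Y} {y' : Y' ⟶ E} (hy : IsPullback y y' p b)
    {f' : X' ⟶ Y'} (h₁ : f' ≫ y = x ≫ f) (h₂ : f' ≫ y' = x') [IsIso f'] : IsIso f := by
  let P : Point B := { obj := X, p := f ≫ p, s := s, s_p := hs }
  let Q : Point B := { obj := Y, p := p, s := s ≫ f, s_p := by simpa using hs }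
  let F : P ⟶ Q := { hom := f, hom_p := rfl, s_hom := rfl }
  have := BournProtomodular.reflectsIsomorphisms b
  have hF : hx.isoPullback.inv ≫ f' ≫ hy.isoPullback.hom =
      pullback.map (f ≫ p) b p b f (𝟙 E) (𝟙 B) (by simp) (by simp) := by
    rw [Iso.inv_comp_eq]
    apply pullback.hom_ext
    · simp [pullback.map, h₁]
    · simp [pullback.map, h₂]
  have : IsIso ((Point.changeOfBase b).map F).hom := by
    change IsIso (pullback.map (f ≫ p) b p b f (𝟙 E) (𝟙 B) (by simp) (by simp))
    rw [← hF]
    infer_instance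
  have : IsIso ((Point.changeOfBase b).map F) := Point.isIso_of_isIso_hom _
  have : IsIso F := isIso_of_reflects_iso F (Point.changeOfBase b)
  exact Point.isIso_hom_of_isIso F

/-- In a protomodular category, a split epimorphism `p : Y ⟶ B` with section `s` has the property
that `s` and any pullback `y : E ×[B] Y ⟶ Y` are jointly extremally epimorphic. -/
theorem isIso_of_mono_of_factors [BournProtomodular C] {E B P Y Y' : C} {b : E ⟶ B}
    {p : Y ⟶ B} {y : Y' ⟶ Y} {y' : Y' ⟶ E} (hy : IsPullback y y' p b)
    (m : P ⟶ Y) [Mono m] {s : B ⟶ P} (hs : s ≫ m ≫ p = 𝟙 B) {l : Y' ⟶ P} (hl : l ≫ m = y) :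
    IsIso m := by
  -- As `y` factors through the mono `m`, the base changes of `p` and of `m ≫ p` coincide, so `m`
  -- pulls back to an identity.
  have hx : IsPullback l y' (m ≫ p) b :=
    { w := by rw [← Category.assoc, hl, hy.w]
      isLimit' := ⟨PullbackCone.IsLimit.mk _
        (fun t => hy.lift (t.fst ≫ m) t.snd (by simpa using t.condition))
        (fun t => by rw [← cancel_mono m, Category.assoc, hl, hy.lift_fst])
        (fun t => hy.lift_snd _ _ _)
        (fun t k h₁ h₂ => hy.hom_ext (by simp [← hl, reassoc_of% h₁]) (by simpa using h₂))⟩ }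
  exact isIso_of_isPullback_of_section hs hx hy (f' := 𝟙 Y') (by simp [hl]) (by simp)

/-- Protomodularity is reflected by conservative functors that preserve pullbacks. -/
theorem BournProtomodular.of_reflectsIsomorphisms [BournProtomodular D] [HasPullbacks C]
    (G : C ⥤ D) [PreservesLimitsOfShape WalkingCospan G] [G.ReflectsIsomorphisms] :
    BournProtomodular C where
  reflectsIsomorphisms {E B} b := ⟨fun {X Y} f _ => by
    have := Point.isIso_hom_of_isIso ((Point.changeOfBase b).map f)
    have hs : G.map X.s ≫ G.map f.hom ≫ G.map Y.p = 𝟙 _ := by simp [← G.map_comp]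
    have hx := (IsPullback.of_hasPullback X.p b).map G
    have hy := (IsPullback.of_hasPullback Y.p b).map G
    have hx' : IsPullback (G.map (pullback.fst X.p b)) (G.map (pullback.snd X.p b))
        (G.map f.hom ≫ G.map Y.p) (G.map b) := by
      rw [← G.map_comp, f.hom_p]; exact hx
    let k : pullback X.p b ⟶ pullback Y.p b := ((Point.changeOfBase b).map f).hom
    have : IsIso k := this
    have hk₁ : k ≫ pullback.fst Y.p b = pullback.fst X.p b ≫ f.hom := pullback.lift_fst _ _ _
    have hk₂ : k ≫ pullback.snd Y.p b = pullback.snd X.p b :=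
      (pullback.lift_snd _ _ _).trans (Category.comp_id _)
    have : IsIso (G.map f.hom) := isIso_of_isPullback_of_section hs hx' hy (f' := G.map k)
      (by rw [← G.map_comp, ← G.map_comp, hk₁]) (by rw [← G.map_comp, hk₂])
    have := isIso_of_reflects_iso f.hom G
    exact Point.isIso_of_isIso_hom f⟩

end Protomodular

/-! ### Equivalence relations and their quotients. -/

section Relations

variable {C : Type*} [Category* C] {D : Type*} [Category* D]

/-- Protomodular categories are Mal'tsev: a reflexive relation is an equivalence relation. -/
theorem isEquivalenceRelation_of_reflexive [HasFiniteLimits C] [BournProtomodular C] {R X : C}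
    {p₁ p₂ : R ⟶ X} [hm : JointlyMono₂ p₁ p₂] {r : X ⟶ R} (h₁ : r ≫ p₁ = 𝟙 X) (h₂ : r ≫ p₂ = 𝟙 X) :
    IsEquivalenceRelation p₁ p₂ := by
  -- the relation is Euclidean: from `x R y` and `x R z` follows `y R z`
  let a := pullback.fst p₁ p₁
  let b := pullback.snd p₁ p₁
  have hab : a ≫ p₁ = b ≫ p₁ := pullback.condition
  have : Mono (prod.lift p₁ p₂) := ⟨fun f g h => hm.right_cancellation f g
    (by simpa using h =≫ prod.fst) (by simpa using h =≫ prod.snd)⟩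
  -- `m` is the subobject of those pairs `(x R y, x R z)` for which `y R z`.
  let m := pullback.fst (prod.lift (a ≫ p₂) (b ≫ p₂)) (prod.lift p₁ p₂)
  let e := pullback.snd (prod.lift (a ≫ p₂) (b ≫ p₂)) (prod.lift p₁ p₂)
  have hme : m ≫ prod.lift (a ≫ p₂) (b ≫ p₂) = e ≫ prod.lift p₁ p₂ := pullback.condition
  have he₁ : e ≫ p₁ = m ≫ a ≫ p₂ := by simpa using (hme =≫ prod.fst).symm
  have he₂ : e ≫ p₂ = m ≫ b ≫ p₂ := by simpa using (hme =≫ prod.snd).symm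
  -- The base change of `a` along `r` consists of the pairs `(x R x, x R z)`.
  have hy : IsPullback (pullback.lift (p₁ ≫ r) (𝟙 R) (by simp [h₁]) : R ⟶ pullback p₁ p₁) p₁ a r :=
    { w := by simp [a]
      isLimit' := ⟨PullbackCone.IsLimit.mk _ (fun t => t.fst ≫ b)
        (fun t => by
          have ht := t.condition
          apply pullback.hom_ext
          · simp only [Category.assoc, pullback.lift_fst]
            rw [← reassoc_of% hab, reassoc_of% ht, reassoc_of% h₁]
            exact ht.symm
          · simp [b])
        (fun t => by
          have ht := t.condition
          rw [Category.assoc, ← hab, reassoc_of% ht, h₁, Category.comp_id])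
        (fun t k hk _ => by rw [← hk]; simp [b])⟩ }
  -- `m` contains the diagonal pairs `(x R y, x R y)`, by reflexivity at `y`, and all pairs `(x R x,
  -- x R z)`; protomodularity forces it to be everything.
  have : IsIso m := by
    refine isIso_of_mono_of_factors hy m
      (s := pullback.lift (pullback.lift (𝟙 R) (𝟙 R) rfl) (p₂ ≫ r) ?_) ?_
      (l := pullback.lift (pullback.lift (p₁ ≫ r) (𝟙 R) (by simp [h₁])) (𝟙 R) ?_) ?_
    · ext <;> simp [a, b, h₁, h₂]
    · simp [m, a]
    · ext <;> simp [a, b, h₂]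
    · simp [m]
  let t : pullback p₁ p₁ ⟶ R := inv m ≫ e
  have ht₁ : t ≫ p₁ = a ≫ p₂ := by simp [t, he₁]
  have ht₂ : t ≫ p₂ = b ≫ p₂ := by simp [t, he₂]
  -- From `x R y` and `x R x` follows `y R x`.
  let σ : R ⟶ R := pullback.lift (𝟙 R) (p₁ ≫ r) (by simp [h₁]) ≫ t
  have hσ₁ : σ ≫ p₁ = p₂ := by simp [σ, ht₁, a]
  have hσ₂ : σ ≫ p₂ = p₁ := by simp [σ, ht₂, b, h₂]
  -- From `x R y` and `y R z`: by symmetry `y R x`, hence `x R z`.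
  let τ : pullback p₂ p₁ ⟶ R := pullback.lift (pullback.fst p₂ p₁ ≫ σ) (pullback.snd p₂ p₁)
    (by simp [hσ₁, pullback.condition]) ≫ t
  have hτ₁ : τ ≫ p₁ = pullback.fst p₂ p₁ ≫ p₁ := by simp [τ, ht₁, a, hσ₂]
  have hτ₂ : τ ≫ p₂ = pullback.snd p₂ p₁ ≫ p₂ := by simp [τ, ht₂, b]
  exact ⟨⟨{
    right_cancellation := hm.right_cancellation
    r := r
    reflexivity₁ := h₁
    reflexivity₂ := h₂
    s := σ
    symmetry₁ := hσ₁
    symmetry₂ := hσ₂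
    c := _
    isLimit := pullbackIsPullback p₂ p₁
    t := τ
    transitivity₁ := hτ₁
    transitivity₂ := hτ₂ }⟩⟩

/-- Jointly monic pairs are preserved by functors that preserve pullbacks and equalizers. -/
theorem jointlyMono_map [HasPullbacks C] [HasEqualizers C] (G : C ⥤ D)
    [PreservesLimitsOfShape WalkingCospan G] [PreservesLimitsOfShape WalkingParallelPair G]
    {R X : C} (p₁ p₂ : R ⟶ X) [hm : JointlyMono₂ p₁ p₂] : JointlyMono₂ (G.map p₁) (G.map p₂) where
  right_cancellation Y f g h₁ h₂ := by
    let a := pullback.fst p₁ p₁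
    let b := pullback.snd p₁ p₁
    -- Joint monicity becomes an equation between pullback and equalizer data. The product `X ⨯ X`
    -- is avoided because the forgetful functor of a slice need not preserve it.
    let i := equalizer.ι (a ≫ p₂) (b ≫ p₂)
    have hi : i ≫ a = i ≫ b := hm.right_cancellation _ _
      (by simp [a, b, pullback.condition]) (by simpa using equalizer.condition (a ≫ p₂) (b ≫ p₂))
    have hG := (IsPullback.of_hasPullback p₁ p₁).map G
    have hE := isLimitForkMapOfIsLimit G (equalizer.condition (a ≫ p₂) (b ≫ p₂))
      (equalizerIsEqualizer _ _)
    let k := hG.lift f g h₁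
    have hk : k ≫ G.map (a ≫ p₂) = k ≫ G.map (b ≫ p₂) := by
      simp only [k, G.map_comp, a, b]
      rw [hG.lift_fst_assoc, hG.lift_snd_assoc, h₂]
    obtain ⟨l, hl⟩ := Fork.IsLimit.lift' hE k hk
    replace hl : l ≫ G.map i = k := hl
    calc f = k ≫ G.map a := (hG.lift_fst _ _ _).symm
      _ = k ≫ G.map b := by simp only [← hl, Category.assoc, ← G.map_comp, hi]
      _ = g := hG.lift_snd _ _ _

theorem isEquivalenceRelation_map [HasPullbacks C] [HasEqualizers C] (G : C ⥤ D)
    [PreservesLimitsOfShape WalkingCospan G] [PreservesLimitsOfShape WalkingParallelPair G]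
    {R X : C} (p₁ p₂ : R ⟶ X) [h : IsEquivalenceRelation p₁ p₂] :
    IsEquivalenceRelation (G.map p₁) (G.map p₂) := by
  obtain ⟨⟨e⟩⟩ := h
  have := e.toJointlyMono₂
  have := jointlyMono_map G p₁ p₂
  exact ⟨⟨{
    __ := e.toReflexiveRelation.map G
    __ := e.toSymmetricRelation.map G
    __ := e.toTransitiveRelation.map G }⟩⟩

theorem isEquivalenceRelation_of_isKernelPair [HasPullbacks C] {R X Y : C} {f : X ⟶ Y}
    {a b : R ⟶ X} (h : IsKernelPair f a b) : IsEquivalenceRelation a b :=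
  ⟨⟨h.equivalenceRelation f a b (pullbackIsPullback b a)⟩⟩

/-- In a Barr exact category every equivalence relation is the kernel pair of a regular
epimorphism. -/
theorem BarrExact.exists_isKernelPair [BarrExact C] {R X : C} (p₁ p₂ : R ⟶ X)
    [IsEquivalenceRelation p₁ p₂] :
    ∃ (Q : C) (q : X ⟶ Q), IsRegularEpi q ∧ IsKernelPair q p₁ p₂ := by
  obtain ⟨⟨e⟩⟩ := BarrExact.isEffective p₁ p₂
  exact ⟨e.B, e.π, inferInstance, e.isKernelPair⟩

theorem BarrExact.hasCoequalizer [BarrExact C] {R X : C} (p₁ p₂ : R ⟶ X)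
    [IsEquivalenceRelation p₁ p₂] : HasCoequalizer p₁ p₂ := by
  obtain ⟨Q, q, _, hq⟩ := BarrExact.exists_isKernelPair p₁ p₂
  exact HasColimit.mk ⟨_, hq.toCoequalizer'⟩

/-- A functor preserves the coequalizer of a kernel pair of `q` if it preserves the kernel pair and
sends `q` to a regular epimorphism. -/
theorem preservesColimit_of_isKernelPair (T : C ⥤ D) {R X Q : C} {q : X ⟶ Q} {p₁ p₂ : R ⟶ X}
    [IsRegularEpi q] [IsRegularEpi (T.map q)] (h : IsKernelPair q p₁ p₂)
    (hT : IsKernelPair (T.map q) (T.map p₁) (T.map p₂)) :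
    PreservesColimit (parallelPair p₁ p₂) T :=
  preservesColimit_of_preserves_colimit_cocone h.toCoequalizer'
    ((isColimitMapCoconeCoforkEquiv T h.w).symm hT.toCoequalizer')

end Relations

/-! ### Lifting exactness along functors that create quotients. -/

section CreatingQuotients

variable {C : Type*} [Category* C] {D : Type*} [Category* D]

theorem hasColimit_parallelPair_comp [BarrExact D] [HasPullbacks C] [HasEqualizers C]
    (G : C ⥤ D) [PreservesLimitsOfShape WalkingCospan G]
    [PreservesLimitsOfShape WalkingParallelPair G] {R X : C} (p₁ p₂ : R ⟶ X)
    [IsEquivalenceRelation p₁ p₂] : HasColimit (parallelPair p₁ p₂ ⋙ G) :=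
  have := isEquivalenceRelation_map G p₁ p₂
  have : HasCoequalizer ((parallelPair p₁ p₂ ⋙ G).map .left)
      ((parallelPair p₁ p₂ ⋙ G).map .right) :=
    BarrExact.hasCoequalizer (G.map p₁) (G.map p₂)
  hasColimit_of_iso (diagramIsoParallelPair _)

/-- If `G` creates the quotients of equivalence relations, then every equivalence relation is
the kernel pair of a morphism whose image under `G` is a regular epimorphism. -/
theorem exists_isKernelPair_of_createsColimit [BarrExact D] [HasPullbacks C] [HasEqualizers C]
    (G : C ⥤ D) [PreservesLimitsOfShape WalkingCospan G]
    [PreservesLimitsOfShape WalkingParallelPair G] [G.ReflectsIsomorphisms]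
    {R X : C} (p₁ p₂ : R ⟶ X) [IsEquivalenceRelation p₁ p₂]
    [CreatesColimit (parallelPair p₁ p₂) G] :
    ∃ (Q : C) (q : X ⟶ Q) (w : p₁ ≫ q = p₂ ≫ q),
      Nonempty (IsColimit (Cofork.ofπ q w)) ∧ IsKernelPair q p₁ p₂ := by
  have := isEquivalenceRelation_map G p₁ p₂
  obtain ⟨Q, q, _, hq⟩ := BarrExact.exists_isKernelPair (G.map p₁) (G.map p₂)
  have := hasColimit_parallelPair_comp G p₁ p₂
  have : HasCoequalizer p₁ p₂ := hasColimit_of_created _ G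
  refine ⟨_, coequalizer.π p₁ p₂, coequalizer.condition p₁ p₂, ⟨coequalizerIsCoequalizer p₁ p₂⟩, ?_⟩
  have : PreservesColimit (parallelPair p₁ p₂) G := inferInstance
  have hG := isColimitCoforkMapOfIsColimit G _ (coequalizerIsCoequalizer p₁ p₂)
  -- Up to `e`, the image under `G` of the created coequalizer is `q`, whose kernel pair is known;
  -- `G` reflects this pullback.
  let e := hG.coconePointUniqueUpToIso hq.toCoequalizer'
  have he : G.map (coequalizer.π p₁ p₂) ≫ e.hom = q :=
    hG.comp_coconePointUniqueUpToIso_hom hq.toCoequalizer' WalkingParallelPair.one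
  have : ReflectsLimitsOfShape WalkingCospan G := reflectsLimitsOfShape_of_reflectsIsomorphisms
  refine IsPullback.of_map G (coequalizer.condition p₁ p₂) ?_
  rw [← he] at hq
  exact hq.cancel_right_of_mono

/-- A regular epimorphism is the coequalizer of its kernel pair, and `G` preserves and reflects both
ingredients. -/
theorem isRegularEpi_iff_map_of_createsColimit [BarrExact D] [HasPullbacks C] [HasEqualizers C]
    (G : C ⥤ D) [PreservesLimitsOfShape WalkingCospan G]
    [PreservesLimitsOfShape WalkingParallelPair G]
    (hG : ∀ {R X : C} (p₁ p₂ : R ⟶ X) [IsEquivalenceRelation p₁ p₂],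
      Nonempty (CreatesColimit (parallelPair p₁ p₂) G)) {X Y : C} (f : X ⟶ Y) :
    IsRegularEpi f ↔ IsRegularEpi (G.map f) := by
  have h : IsKernelPair f _ _ := IsKernelPair.of_hasPullback f
  have := isEquivalenceRelation_of_isKernelPair h
  have := hasColimit_parallelPair_comp G (pullback.fst f f) (pullback.snd f f)
  obtain ⟨_⟩ := hG (pullback.fst f f) (pullback.snd f f)
  constructor
  · intro _
    exact ⟨⟨Cofork.IsColimit.regularEpi (isColimitCoforkMapOfIsColimit G _ h.toCoequalizer')⟩⟩
  · intro _
    exact ⟨⟨Cofork.IsColimit.regularEpi (isColimitOfIsColimitCoforkMap G h.w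
      (IsKernelPair.toCoequalizer' (h.map G)))⟩⟩

/-- A coequalizer of a pair with a common section is also a pushout of this pair. -/
theorem isPushout_of_isColimitCofork {R X Q : C} {p₁ p₂ : R ⟶ X} {r : X ⟶ R} {q : X ⟶ Q}
    (h₁ : r ≫ p₁ = 𝟙 X) (h₂ : r ≫ p₂ = 𝟙 X) {w : p₁ ≫ q = p₂ ≫ q}
    (hq : IsColimit (Cofork.ofπ q w)) : IsPushout p₁ p₂ q q := by
  have key (s : PushoutCocone p₁ p₂) : s.inl = s.inr := by
    simpa [reassoc_of% h₁, reassoc_of% h₂] using r ≫= s.condition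
  have hs (s : PushoutCocone p₁ p₂) : p₁ ≫ s.inl = p₂ ≫ s.inl := by
    rw [s.condition, key]
  exact {
    w := w
    isColimit' := ⟨PushoutCocone.IsColimit.mk _
      (fun s => Cofork.IsColimit.desc hq s.inl (hs s))
      (fun s => Cofork.IsColimit.π_desc' hq _ (hs s))
      (fun s => (Cofork.IsColimit.π_desc' hq _ (hs s)).trans (key s))
      (fun s m hm _ => Cofork.IsColimit.hom_ext hq
        (hm.trans (Cofork.IsColimit.π_desc' hq _ (hs s)).symm))⟩ }

/-- Barr exactness lifts along functors that preserve enough finite limits, reflect isomorphisms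
and create the quotients of equivalence relations. -/
theorem BarrExact.of_createsColimit [BarrExact D] [HasFiniteLimits C]
    (G : C ⥤ D) [PreservesLimitsOfShape WalkingCospan G]
    [PreservesLimitsOfShape WalkingParallelPair G] [G.ReflectsIsomorphisms]
    (hG : ∀ {R X : C} (p₁ p₂ : R ⟶ X) [IsEquivalenceRelation p₁ p₂],
      Nonempty (CreatesColimit (parallelPair p₁ p₂) G)) : BarrExact C where
  hasCoequalizer_of_isKernelPair {X Y Z f g₁ g₂} h := by
    have := isEquivalenceRelation_of_isKernelPair h
    obtain ⟨_⟩ := hG g₁ g₂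
    obtain ⟨Q, q, w, ⟨hq⟩, -⟩ := exists_isKernelPair_of_createsColimit G g₁ g₂
    exact HasColimit.mk ⟨_, hq⟩
  regularEpiIsStableUnderBaseChange := by
    refine MorphismProperty.IsStableUnderBaseChange.mk fun {X Y Y' S} f g f' g' h hg => ?_
    rw [MorphismProperty.regularEpi_iff, isRegularEpi_iff_map_of_createsColimit G hG] at hg ⊢
    exact Regular.regularEpiIsStableUnderBaseChange.of_isPullback (h.map G) hg
  isEffective {R X} p₁ p₂ h := by
    obtain ⟨_⟩ := hG p₁ p₂
    obtain ⟨Q, q, w, ⟨hq⟩, hk⟩ := exists_isKernelPair_of_createsColimit G p₁ p₂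
    obtain ⟨⟨e⟩⟩ := h
    exact ⟨⟨{
      __ := e
      B := Q
      π := q
      isKernelPair := hk
      isPushout := isPushout_of_isColimitCofork e.reflexivity₁ e.reflexivity₂ hq }⟩⟩

end CreatingQuotients

/-! ### Reflexive coequalizers in exact protomodular categories. -/

section ReflexiveCoequalizers

variable {C : Type*} [Category* C] {D : Type*} [Category* D]

/-- In an exact protomodular category, a reflexive pair `f, g` has the same coequalizer as an
equivalence relation, namely its image. -/
theorem exists_image_of_isReflexivePair [BarrExact C] [BournProtomodular C] {X Y : C}
    (f g : X ⟶ Y) [IsReflexivePair f g] :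
    ∃ (R Q : C) (e : X ⟶ R) (p₁ p₂ : R ⟶ Y) (q : Y ⟶ Q),
      IsRegularEpi e ∧ IsRegularEpi q ∧ e ≫ p₁ = f ∧ e ≫ p₂ = g ∧ IsKernelPair q p₁ p₂ := by
  let F := Regular.strongEpiMonoFactorisation (prod.lift f g)
  have h₁ : F.e ≫ F.m ≫ prod.fst = f := by
    rw [← Category.assoc, F.fac, prod.lift_fst]
  have h₂ : F.e ≫ F.m ≫ prod.snd = g := by
    rw [← Category.assoc, F.fac, prod.lift_snd]
  have : JointlyMono₂ (F.m ≫ prod.fst) (F.m ≫ prod.snd) := ⟨fun _ a b h h' => by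
    rw [← cancel_mono F.m]
    ext
    · simpa using h
    · simpa using h'⟩
  have := isEquivalenceRelation_of_reflexive (p₁ := F.m ≫ prod.fst) (p₂ := F.m ≫ prod.snd)
    (r := commonSection f g ≫ F.e) (by simp [h₁]) (by simp [h₂])
  obtain ⟨Q, q, hq, hk⟩ := BarrExact.exists_isKernelPair (F.m ≫ prod.fst) (F.m ≫ prod.snd)
  exact ⟨F.I, Q, F.e, _, _, q,
    inferInstanceAs (IsRegularEpi (Regular.strongEpiMonoFactorisation _).e), hq, h₁, h₂, hk⟩

/-- Precomposing a parallel pair with an epimorphism does not change its coequalizer. -/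
noncomputable def isColimitCoforkOfEpi {X R Y Q : C} {f g : X ⟶ Y} {e : X ⟶ R} [Epi e]
    {p₁ p₂ : R ⟶ Y} {q : Y ⟶ Q} (h₁ : e ≫ p₁ = f) (h₂ : e ≫ p₂ = g) (w : p₁ ≫ q = p₂ ≫ q)
    (hq : IsColimit (Cofork.ofπ q w)) :
    IsColimit (Cofork.ofπ q (show f ≫ q = g ≫ q by rw [← h₁, ← h₂]; simp [w])) :=
  Cofork.IsColimit.mk' _ fun s =>
    have hs : p₁ ≫ s.π = p₂ ≫ s.π := by
      rw [← cancel_epi e, reassoc_of% h₁, reassoc_of% h₂, s.condition]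
    ⟨Cofork.IsColimit.desc hq s.π hs, Cofork.IsColimit.π_desc' hq s.π hs,
      fun hm => Cofork.IsColimit.hom_ext hq
        (hm.trans (Cofork.IsColimit.π_desc' hq s.π hs).symm)⟩

theorem hasReflexiveCoequalizers_of_barrExact [BarrExact C] [BournProtomodular C] :
    HasReflexiveCoequalizers C where
  has_coeq X Y f g _ := by
    obtain ⟨R, Q, e, p₁, p₂, q, _, _, h₁, h₂, hk⟩ := exists_image_of_isReflexivePair f g
    exact HasColimit.mk ⟨_, isColimitCoforkOfEpi h₁ h₂ hk.w hk.toCoequalizer'⟩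

/-- `G` preserves the cover onto the image relation and the kernel pair with its quotient, so the
description of the coequalizer carries over. This is the input to crude monadicity. -/
theorem preservesColimit_parallelPair_of_isReflexivePair [BarrExact C] [BournProtomodular C]
    (G : C ⥤ D) [PreservesLimitsOfShape WalkingCospan G] (hG : PreservesRegularEpis G) {X Y : C}
    (f g : X ⟶ Y) [IsReflexivePair f g] : PreservesColimit (parallelPair f g) G := by
  obtain ⟨R, Q, e, p₁, p₂, q, he, hq, h₁, h₂, hk⟩ := exists_image_of_isReflexivePair f g
  have := hG e he
  have := hG q hq
  have hk' : IsKernelPair (G.map q) (G.map p₁) (G.map p₂) := hk.map G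
  refine preservesColimit_of_preserves_colimit_cocone
    (isColimitCoforkOfEpi h₁ h₂ hk.w hk.toCoequalizer') ?_
  refine (isColimitMapCoconeCoforkEquiv G _).symm ?_
  exact isColimitCoforkOfEpi (e := G.map e) (by rw [← G.map_comp, h₁]) (by rw [← G.map_comp, h₂])
    hk'.w hk'.toCoequalizer'

end ReflexiveCoequalizers

/-! ### Crude monadicity and properties of monadic functors. -/

section Monadic

variable {C : Type*} [Category* C] {D : Type*} [Category* D]

/-- If `G` reflects isomorphisms and preserves reflexive coequalizers, the counit of an adjunction
with right adjoint `G` is a coequalizer. -/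
theorem isColimit_counit_of_reflexive {F : C ⥤ D} {G : D ⥤ C} (adj : F ⊣ G)
    [HasReflexiveCoequalizers D] [G.ReflectsIsomorphisms]
    (hG : ∀ {X Y : D} (f g : X ⟶ Y) [IsReflexivePair f g], PreservesColimit (parallelPair f g) G)
    (B : D) : Nonempty (IsColimit (Cofork.ofπ (f := F.map (G.map (adj.counit.app B)))
      (g := adj.counit.app (F.obj (G.obj B))) (adj.counit.app B) (adj.counit_naturality _))) := by
  let f : F.obj (G.obj (F.obj (G.obj B))) ⟶ F.obj (G.obj B) := F.map (G.map (adj.counit.app B))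
  let g : F.obj (G.obj (F.obj (G.obj B))) ⟶ F.obj (G.obj B) := adj.counit.app (F.obj (G.obj B))
  have : IsReflexivePair f g :=
    inferInstanceAs (IsReflexivePair (F.map (G.map (adj.counit.app B)))
      (adj.counit.app (F.obj (G.obj B))))
  have := hG f g
  have : ReflectsColimit (parallelPair f g) G := reflectsColimit_of_reflectsIsomorphisms _ _
  -- Under `G` the fork becomes Beck's split coequalizer, and `G` reflects it.
  exact ⟨isColimitOfIsColimitCoforkMap G (f := f) (g := g) _
    (Monad.beckCoequalizer ((Monad.comparison adj).obj B))⟩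

/-- The crude monadicity theorem, without restrictions on the universes of the homs. -/
theorem isEquivalence_comparison_of_reflexive {F : C ⥤ D} {G : D ⥤ C} (adj : F ⊣ G)
    [HasReflexiveCoequalizers D] [G.ReflectsIsomorphisms]
    (hG : ∀ {X Y : D} (f g : X ⟶ Y) [IsReflexivePair f g], PreservesColimit (parallelPair f g) G) :
    (Monad.comparison adj).IsEquivalence := by
  let ε (B : D) : F.obj (G.obj B) ⟶ B := adj.counit.app B
  let η (X : C) : X ⟶ G.obj (F.obj X) := adj.unit.app X
  have hε {A B : D} (f : A ⟶ B) : F.map (G.map f) ≫ ε B = ε A ≫ f := adj.counit_naturality f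
  have hη (B : D) : η (G.obj B) ≫ G.map (ε B) = 𝟙 _ := adj.right_triangle_components B
  have hη' (X : C) : F.map (η X) ≫ ε (F.obj X) = 𝟙 _ := adj.left_triangle_components X
  refine { faithful := ⟨fun {A B} f g h => ?_⟩, full := ⟨fun {A B} h => ?_⟩,
           essSurj := ⟨fun Z => ?_⟩ }
  · obtain ⟨hA⟩ := isColimit_counit_of_reflexive adj hG A
    have h' : G.map f = G.map g := congrArg Monad.Algebra.Hom.f h
    refine Cofork.IsColimit.hom_ext hA ?_
    change ε A ≫ f = ε A ≫ g
    rw [← hε, ← hε, h']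
  · obtain ⟨hA⟩ := isColimit_counit_of_reflexive adj hG A
    let h' : G.obj A ⟶ G.obj B := h.f
    have hh : G.map (F.map h') ≫ G.map (ε B) = G.map (ε A) ≫ h' := h.h
    have hk : F.map (G.map (ε A)) ≫ F.map h' ≫ ε B = ε (F.obj (G.obj A)) ≫ F.map h' ≫ ε B := by
      rw [← F.map_comp_assoc, ← hh, F.map_comp_assoc, hε, reassoc_of% (hε (F.map h'))]
    obtain ⟨k, hd⟩ : ∃ k : A ⟶ B, ε A ≫ k = F.map h' ≫ ε B :=
      ⟨Cofork.IsColimit.desc hA _ hk, Cofork.IsColimit.π_desc' hA _ hk⟩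
    refine ⟨k, ?_⟩
    ext
    change G.map k = h'
    rw [← Category.id_comp (G.map k), ← hη, Category.assoc, ← G.map_comp, hd, G.map_comp, hh,
      reassoc_of% (hη A)]
  · let z : G.obj (F.obj Z.A) ⟶ Z.A := Z.a
    have hz : η Z.A ≫ z = 𝟙 Z.A := Z.unit
    have : IsReflexivePair (F.map z) (ε (F.obj Z.A)) :=
      IsReflexivePair.mk' (F.map (η Z.A)) (by rw [← F.map_comp, hz, F.map_id]) (hη' _)
    have := hG (F.map z) (ε (F.obj Z.A))
    let Q := coequalizer (F.map z) (ε (F.obj Z.A))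
    let q : F.obj Z.A ⟶ Q := coequalizer.π (F.map z) (ε (F.obj Z.A))
    have hq : F.map z ≫ q = ε (F.obj Z.A) ≫ q := coequalizer.condition _ _
    have hGq := isColimitCoforkMapOfIsColimit G hq (coequalizerIsCoequalizer _ _)
    -- Both `z` and `G.map q` are coequalizers of the pair presenting the algebra `Z`.
    let i : Z.A ≅ G.obj Q := (Monad.beckCoequalizer Z).coconePointUniqueUpToIso hGq
    have hi : z ≫ i.hom = G.map q :=
      (Monad.beckCoequalizer Z).comp_coconePointUniqueUpToIso_hom hGq WalkingParallelPair.one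
    have hi' : i.hom = η Z.A ≫ G.map q := by
      rw [← Category.id_comp i.hom, ← hz, Category.assoc, hi]
    have h : G.map (F.map i.hom) ≫ G.map (ε Q) = z ≫ i.hom := by
      rw [hi, ← G.map_comp, hi', F.map_comp, Category.assoc, hε, reassoc_of% (hη' Z.A)]
    exact ⟨Q, ⟨(Monad.Algebra.isoMk i h).symm⟩⟩

/-- The counit of a monadic adjunction is a regular epimorphism. -/
theorem isRegularEpi_monadicAdjunction_counit (U : D ⥤ C) [MonadicRightAdjoint U] (B : D) :
    IsRegularEpi ((monadicAdjunction U).counit.app B) :=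
  ⟨⟨Cofork.IsColimit.regularEpi (isColimitOfIsColimitCoforkMap
    (Monad.comparison (monadicAdjunction U)) ((monadicAdjunction U).counit_naturality _)
    (Monad.beckAlgebraCoequalizer ((Monad.comparison (monadicAdjunction U)).obj B)))⟩⟩

theorem reflectsIsomorphisms_of_monadic (U : D ⥤ C) [MonadicRightAdjoint U] :
    U.ReflectsIsomorphisms :=
  reflectsIsomorphisms_of_iso (Monad.comparisonForget (monadicAdjunction U))

/-- If the codomain of a monadic functor `U` has coproducts indexed by `J`, so does its domain,
provided it has reflexive coequalizers. -/
theorem hasColimitsOfShape_discrete_of_monadic (U : D ⥤ C) [MonadicRightAdjoint U]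
    [HasReflexiveCoequalizers D] (J : Type*) [HasColimitsOfShape (Discrete J) C] :
    HasColimitsOfShape (Discrete J) D := by
  rw [hasColimitsOfShape_iff_isRightAdjoint_const]
  let adj := (monadicAdjunction U).whiskerRight (Discrete J)
  have : (Functor.const (Discrete J) : C ⥤ _).IsRightAdjoint :=
    hasColimitsOfShape_iff_isRightAdjoint_const.1 inferInstance
  have : ((Functor.const (Discrete J) : D ⥤ _) ⋙
      (Functor.whiskeringRight (Discrete J) D C).obj U).IsRightAdjoint :=
    Functor.isRightAdjoint_of_iso (F := U ⋙ (Functor.const (Discrete J) : C ⥤ _))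
      (NatIso.ofComponents fun X => Discrete.natIso fun _ => Iso.refl _)
  -- Adjoint triangle theorem: the diagonal of `D` followed by `U` pointwise has a left adjoint, and
  -- the pointwise counits are regular epimorphisms.
  refine isRightAdjoint_triangle_lift _ adj fun X => ?_
  have h (j : J) : RegularEpi (adj.counit.app X |>.app ⟨j⟩) := by
    have := isRegularEpi_monadicAdjunction_counit U (X.obj ⟨j⟩)
    have e : (adj.counit.app X).app ⟨j⟩ = (monadicAdjunction U).counit.app (X.obj ⟨j⟩) := by
      simp [adj]
    rw [e]
    exact IsRegularEpi.getStruct _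
  exact {
    W := Discrete.functor fun j => (h j).W
    left := Discrete.natTrans fun j => (h j.as).left
    right := Discrete.natTrans fun j => (h j.as).right
    w := by ext ⟨j⟩; exact (h j).w
    isColimit := Cofork.IsColimit.mk _
      (fun s => Discrete.natTrans fun j => Cofork.IsColimit.desc (h j.as).isColimit (s.π.app j)
        (congrArg (fun t => t.app j) s.condition))
      (fun s => by
        ext ⟨j⟩
        exact Cofork.IsColimit.π_desc' (h j).isColimit _ _)
      (fun s m hm => by
        ext ⟨j⟩
        exact Cofork.IsColimit.hom_ext (h j).isColimit
          ((congrArg (fun t => t.app ⟨j⟩) hm).trans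
            (Cofork.IsColimit.π_desc' (h j).isColimit _ _).symm)) }

end Monadic

/-! ### The slice over the initial object is semi-abelian. -/

section IdeallyExactToSemiAbelian

variable {C : Type*} [Category* C] {D : Type*} [Category* D]

/-- Left adjoints preserve regular epimorphisms. -/
theorem preservesRegularEpis_of_isLeftAdjoint (F : C ⥤ D) [F.IsLeftAdjoint] :
    PreservesRegularEpis F := fun _ _ f _ =>
  ⟨⟨Cofork.IsColimit.regularEpi
    (isColimitCoforkMapOfIsColimit F (IsRegularEpi.w f) (IsRegularEpi.isColimit f))⟩⟩

theorem preservesKernelPairs_of_preservesPullbacks (F : C ⥤ D)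
    [PreservesLimitsOfShape WalkingCospan F] : PreservesKernelPairs F :=
  fun _ _ _ _ _ _ h => h.map F

theorem isRegularEpi_prod_map [Regular C] (B : C) {X Y : C} (f : X ⟶ Y) [hf : IsRegularEpi f] :
    IsRegularEpi (prod.map (𝟙 B) f) := by
  -- `prod.map (𝟙 B) f` is the base change of `f` along a projection.
  have h : IsPullback (prod.snd : B ⨯ X ⟶ X) (prod.map (𝟙 B) f) f prod.snd :=
    { w := (prod.map_snd _ _).symm
      isLimit' := ⟨PullbackCone.IsLimit.mk _
        (fun s => prod.lift (s.snd ≫ prod.fst) s.fst)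
        (fun s => prod.lift_snd _ _)
        (fun s => by ext <;> simp [s.condition])
        (fun s m h₁ h₂ => by
          ext
          · simp [← h₂]
          · simpa using h₁)⟩ }
  exact Regular.regularEpiIsStableUnderBaseChange.of_isPullback h hf

theorem isRegularEpi_prod_snd [Regular C] {B : C} [hB : IsRegularEpi (terminal.from B)] (X : C) :
    IsRegularEpi (prod.snd : B ⨯ X ⟶ X) :=
  Regular.regularEpiIsStableUnderBaseChange.of_isPullback
    (IsPullback.of_is_product (prodIsProd B X) terminalIsTerminal) hB

/-- If `B` has global support, then the functor `B × -` reflects isomorphisms. -/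
theorem isIso_of_isIso_prod_map [Regular C] {B : C} [IsRegularEpi (terminal.from B)] {X Y : C}
    (f : X ⟶ Y) [IsIso (prod.map (𝟙 B) f)] : IsIso f := by
  have := isRegularEpi_prod_snd (B := B)
  have : Mono f := ⟨fun {Z} a b h => by
    have hp : prod.map (𝟙 B) a = prod.map (𝟙 B) b := by
      rw [← cancel_mono (prod.map (𝟙 B) f), prod.map_map, prod.map_map, h]
    rw [← cancel_epi (prod.snd : B ⨯ Z ⟶ Z), ← prod.map_snd (𝟙 B) a, hp, prod.map_snd]⟩
  have : StrongEpi ((prod.snd : B ⨯ X ⟶ X) ≫ f) := by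
    rw [← prod.map_snd (𝟙 B) f]
    exact strongEpi_comp _ _
  have : StrongEpi f := strongEpi_of_strongEpi (prod.snd : B ⨯ X ⟶ X) f
  exact isIso_of_mono_of_strongEpi f

theorem reflectsIsomorphisms_star [Regular C] {B : C} [IsRegularEpi (terminal.from B)] :
    (Over.star B).ReflectsIsomorphisms where
  reflects {X Y} f _ := by
    have : IsIso (prod.map (𝟙 B) f) := by
      rw [← Over.star_map_left]
      exact inferInstanceAs (IsIso ((Over.forget B).map ((Over.star B).map f)))
    exact isIso_of_isIso_prod_map (B := B) f

variable {B : C}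

/-- Barr exactness passes to categories equivalent to a slice. -/
theorem BarrExact.of_over [BarrExact C] (e : Over B ≌ D) : BarrExact D :=
  have : HasFiniteLimits D :=
    ⟨fun _ _ _ => Adjunction.hasLimitsOfShape_of_equivalence e.inverse⟩
  -- The forgetful functor of a slice creates colimits and preserves pullbacks and equalizers.
  BarrExact.of_createsColimit (e.inverse ⋙ Over.forget B) fun _ _ _ => ⟨inferInstance⟩

/-- Protomodularity passes to categories equivalent to a slice. -/
theorem BournProtomodular.of_over [BournProtomodular C] (e : Over B ≌ D) : BournProtomodular D :=
  have : HasPullbacks D := Adjunction.hasLimitsOfShape_of_equivalence e.inverse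
  BournProtomodular.of_reflectsIsomorphisms (e.inverse ⋙ Over.forget B)

theorem hasZeroObject_of_over (hB : IsInitial B) (e : Over B ≌ D) : HasZeroObject D :=
  have hI : IsInitial (Over.mk (𝟙 B)) := IsInitial.ofUniqueHom
    (fun _ => Over.homMk (hB.to _) (hB.hom_ext _ _))
    (fun _ _ => Over.OverMorphism.ext (hB.hom_ext _ _))
  have hI' : IsInitial (e.functor.obj (Over.mk (𝟙 B))) := IsInitial.isInitialObj _ _ hI
  have hT' : IsTerminal (e.functor.obj (Over.mk (𝟙 B))) :=
    IsTerminal.isTerminalObj _ _ Over.mkIdTerminal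
  ⟨_, { unique_to := fun Y => ⟨⟨⟨hI'.to Y⟩, fun _ => hI'.hom_ext _ _⟩⟩
        unique_from := fun Y => ⟨⟨⟨hT'.from Y⟩, fun _ => hT'.hom_ext _ _⟩⟩ }⟩

theorem SemiAbelian.of_over [BarrExact C] [BournProtomodular C] [HasFiniteCoproducts C]
    (hB : IsInitial B) (e : Over B ≌ D) : SemiAbelian D where
  __ := hasZeroObject_of_over hB e
  __ := BarrExact.of_over e
  __ := BournProtomodular.of_over e
  hasFiniteCoproducts := ⟨fun _ =>
    Adjunction.hasColimitsOfShape_of_equivalence e.inverse⟩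

end IdeallyExactToSemiAbelian

/-! ### Monadicity of `B × -` over the slice. -/

section MonadicOverSlice

variable {C : Type*} [Category* C] {D : Type*} [Category* D]

/-- If `B → 1` is a regular epimorphism in an exact protomodular category, then `B × -` is monadic
over (any category equivalent to) the slice over `B`. -/
theorem exists_monadic_of_over [BarrExact C] [BournProtomodular C] {B : C}
    [IsRegularEpi (terminal.from B)] (e : Over B ≌ D) :
    ∃ (U : C ⥤ D) (_ : MonadicRightAdjoint U),
      PreservesRegularEpis (monadicAdjunction U).toMonad.toFunctor ∧
        PreservesKernelPairs (monadicAdjunction U).toMonad.toFunctor := by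
  have : BarrExact D := BarrExact.of_over e
  have := reflectsIsomorphisms_star (B := B)
  have : HasReflexiveCoequalizers C := hasReflexiveCoequalizers_of_barrExact
  let U : C ⥤ D := Over.star B ⋙ e.functor
  let F : D ⥤ C := e.inverse ⋙ Over.forget B
  let adj : F ⊣ U := e.symm.toAdjunction.comp (Over.forgetAdjStar B)
  have hU : PreservesRegularEpis U := fun X Y f _ => by
    refine preservesRegularEpis_of_isLeftAdjoint e.functor _ ?_
    rw [isRegularEpi_iff_map_of_createsColimit (Over.forget B) fun _ _ _ => ⟨inferInstance⟩]
    have h : (Over.forget B).map ((Over.star B).map f) = prod.map (𝟙 B) f :=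
      Over.star_map_left B f
    exact h ▸ isRegularEpi_prod_map B f
  let M : MonadicRightAdjoint U :=
    { L := F
      adj := adj
      eqv := isEquivalence_comparison_of_reflexive adj fun f g _ =>
        preservesColimit_parallelPair_of_isReflexivePair U hU f g }
  refine ⟨U, M, ?_, ?_⟩
  · change PreservesRegularEpis (F ⋙ U)
    exact fun _ _ f hf => hU _ (preservesRegularEpis_of_isLeftAdjoint F f hf)
  · change PreservesKernelPairs (F ⋙ U)
    exact preservesKernelPairs_of_preservesPullbacks _

end MonadicOverSlice

/-! ### Consequences of monadicity over a semi-abelian category. -/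

section MonadicOverSemiAbelian

variable {C : Type*} [Category* C] {D : Type*} [Category* D]

/-- By exactness an equivalence relation is a kernel pair, so `T` need not preserve all pullbacks.
-/
theorem isEquivalenceRelation_map_of_preservesKernelPairs [BarrExact C] [HasPullbacks D]
    {T : C ⥤ D} (hT : PreservesKernelPairs T) {R X : C} (p₁ p₂ : R ⟶ X)
    [IsEquivalenceRelation p₁ p₂] : IsEquivalenceRelation (T.map p₁) (T.map p₂) := by
  obtain ⟨Q, q, hq, hk⟩ := BarrExact.exists_isKernelPair p₁ p₂
  exact isEquivalenceRelation_of_isKernelPair (hT _ _ _ hk)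

theorem preservesColimit_of_preservesKernelPairs [BarrExact C]
    {T : C ⥤ D} (hT : PreservesRegularEpis T) (hT' : PreservesKernelPairs T)
    (K : WalkingParallelPair ⥤ C) [h : IsEquivalenceRelation (K.map .left) (K.map .right)] :
    PreservesColimit K T := by
  obtain ⟨Q, q, hq, hk⟩ := BarrExact.exists_isKernelPair (K.map .left) (K.map .right)
  have := hT q hq
  have := preservesColimit_of_isKernelPair T hk (hT' _ _ _ hk)
  exact preservesColimit_of_iso_diagram T (diagramIsoParallelPair K).symm

theorem hasFiniteLimits_of_monadic (U : D ⥤ C) [MonadicRightAdjoint U] [HasFiniteLimits C] :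
    HasFiniteLimits D where
  out _ _ _ :=
    have := monadicCreatesLimits U
    hasLimitsOfShape_of_hasLimitsOfShape_createsLimitsOfShape U

theorem BournProtomodular.of_monadic (U : D ⥤ C) [MonadicRightAdjoint U] [BournProtomodular C]
    [HasPullbacks D] : BournProtomodular D :=
  have := reflectsIsomorphisms_of_monadic U
  BournProtomodular.of_reflectsIsomorphisms U

/-- The category of algebras is Barr exact if the monad preserves regular epimorphisms and kernel
pairs. -/
theorem BarrExact.of_monadic (U : D ⥤ C) [MonadicRightAdjoint U] [BarrExact C]
    (hT : PreservesRegularEpis (monadicAdjunction U).toMonad.toFunctor)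
    (hT' : PreservesKernelPairs (monadicAdjunction U).toMonad.toFunctor) : BarrExact D := by
  have := reflectsIsomorphisms_of_monadic U
  have := hasFiniteLimits_of_monadic U
  refine BarrExact.of_createsColimit U fun p₁ p₂ _ => ?_
  have : IsEquivalenceRelation (((parallelPair p₁ p₂) ⋙ U).map .left)
      (((parallelPair p₁ p₂) ⋙ U).map .right) := isEquivalenceRelation_map U p₁ p₂
  have : IsEquivalenceRelation
      ((((parallelPair p₁ p₂) ⋙ U) ⋙ monadicLeftAdjoint U ⋙ U).map .left)
      ((((parallelPair p₁ p₂) ⋙ U) ⋙ monadicLeftAdjoint U ⋙ U).map .right) :=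
    isEquivalenceRelation_map_of_preservesKernelPairs hT' (((parallelPair p₁ p₂) ⋙ U).map .left)
      (((parallelPair p₁ p₂) ⋙ U).map .right)
  -- To create the quotient, the monad must preserve the coequalizer of the underlying pair and that
  -- of its image under the monad.
  have : PreservesColimit (parallelPair p₁ p₂ ⋙ U) (monadicLeftAdjoint U ⋙ U) :=
    preservesColimit_of_preservesKernelPairs hT hT' _
  have : PreservesColimit ((parallelPair p₁ p₂ ⋙ U) ⋙ monadicLeftAdjoint U ⋙ U)
      (monadicLeftAdjoint U ⋙ U) :=
    preservesColimit_of_preservesKernelPairs hT hT' _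
  exact ⟨monadicCreatesColimitOfPreservesColimit U _⟩

theorem hasFiniteCoproducts_of_monadic (U : D ⥤ C) [MonadicRightAdjoint U] [BournProtomodular C]
    [HasFiniteCoproducts C] [BarrExact D] : HasFiniteCoproducts D :=
  have := BournProtomodular.of_monadic U
  have : HasReflexiveCoequalizers D := hasReflexiveCoequalizers_of_barrExact
  ⟨fun n => hasColimitsOfShape_discrete_of_monadic U (Fin n)⟩

/-- If `U` is monadic over a pointed category, then `0 ⟶ 1` is a regular epimorphism, as it is the
counit of the adjunction at the terminal object. -/
theorem isRegularEpi_initial_to_terminal (U : D ⥤ C) [MonadicRightAdjoint U] [HasZeroObject C]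
    [HasInitial D] [HasTerminal D] : IsRegularEpi (initial.to (⊤_ D)) := by
  have hε := isRegularEpi_monadicAdjunction_counit U (⊤_ D)
  have hU : IsTerminal (U.obj (⊤_ D)) := IsTerminal.isTerminalObj U _ terminalIsTerminal
  let i := hU.uniqueUpToIso HasZeroObject.zeroIsTerminal
  have h₀ : IsInitial (U.obj (⊤_ D)) := HasZeroObject.zeroIsInitial.ofIso i.symm
  have hF : IsInitial ((monadicLeftAdjoint U).obj (U.obj (⊤_ D))) :=
    have := (monadicAdjunction U).leftAdjoint_preservesColimits
    IsInitial.isInitialObj _ _ h₀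
  have h : initial.to (⊤_ D) = (initialIsInitial.uniqueUpToIso hF).hom ≫
      (monadicAdjunction U).counit.app (⊤_ D) := initialIsInitial.hom_ext _ _
  rw [h]
  exact (MorphismProperty.cancel_left_of_respectsIso (.regularEpi D) _ _).2 hε

end MonadicOverSemiAbelian

end IdeallyExact

theorem theorem3p1 (A : Type u) [Category.{v} A] :
    List.TFAE [
      -- (a)
      ∃ (_ : IdeallyExact.BarrExact A) (_ : IdeallyExact.BournProtomodular A)
        (_ : HasFiniteCoproducts A), IsRegularEpi (initial.to (⊤_ A)),
      -- (b)
      IdeallyExact.BarrExact A ∧ HasFiniteCoproducts A ∧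
        ∃ (X : Type (max u v w)) (_ : Category.{max v w'} X) (U : A ⥤ X),
          IdeallyExact.SemiAbelian X ∧ Nonempty (MonadicRightAdjoint U),
      -- (c)
      ∃ (X : Type (max u v w)) (_ : Category.{max v w'} X) (U : A ⥤ X)
        (_ : MonadicRightAdjoint U), IdeallyExact.SemiAbelian X ∧
          IdeallyExact.PreservesRegularEpis (monadicAdjunction U).toMonad.toFunctor ∧
          IdeallyExact.PreservesKernelPairs (monadicAdjunction U).toMonad.toFunctor] := by
  tfae_have 1 → 3 := by
    rintro ⟨_, _, _, h⟩
    have : IsRegularEpi (terminal.from (⊥_ A)) := by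
      rwa [Subsingleton.elim (terminal.from (⊥_ A)) (initial.to (⊤_ A))]
    -- The slice is lifted to the universes prescribed for `X`.
    let X : Type (max u v w) := ULiftHom.{w'} (ULift.{w} (Over (⊥_ A)))
    let _ : Category.{v} (ULift.{w} (Over (⊥_ A))) := uliftCategory _
    let _ : Category.{max v w'} X := ULiftHom.category.{v, w'}
    let e : Over (⊥_ A) ≌ X := ULiftHomULiftCategory.equiv.{w', w} (Over (⊥_ A))
    obtain ⟨U, M, h₁, h₂⟩ := IdeallyExact.exists_monadic_of_over e
    exact ⟨X, _, U, M, IdeallyExact.SemiAbelian.of_over initialIsInitial e, h₁, h₂⟩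
  tfae_have 3 → 2 := by
    rintro ⟨X, _, U, M, _, h₁, h₂⟩
    have := IdeallyExact.BarrExact.of_monadic U h₁ h₂
    exact ⟨this, IdeallyExact.hasFiniteCoproducts_of_monadic U, X, _, U, inferInstance, ⟨M⟩⟩
  tfae_have 2 → 1 := by
    rintro ⟨_, _, X, _, U, _, ⟨_⟩⟩
    exact ⟨inferInstance, IdeallyExact.BournProtomodular.of_monadic U, inferInstance,
      IdeallyExact.isRegularEpi_initial_to_terminal U⟩
  tfae_finish
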